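/- For a finite simple graph $G$ and $r\ge 1$, let $\mathcal C_r(G)$ be the $(r+1)$-uniform clutter on $V(G)$ whose edges are the $(r+1)$-subsets $S\subseteq V(G)$ such that the induced subgraph $G[S]$ is connected. For a $d$-uniform clutter $\mathcal C$ on a finite set $V$: - $\overline{\mathcal C}$ is the $d$-uniform clutter on $V$ whose edges are the $d$-subsets of $V$ that are not edges of $\mathcal C$. - For a $(d-1)$-subset $\sigma\subseteq V$ put $N_{\mathcal C}[\sigma]=\sigma\cup\{v\in V : \sigma\cup\{v\}\in E(\mathcal C)\}$. The set $\sigma$ is a simplicial maximal subedge if $N_{\mathcal C}[\sigma]\ne\sigma$ and every $d$-subset of $N_{\mathcal C}[\sigma]$ is an edge of $\mathcal C$. - $\mathcal C$ is chordal if $E(\mathcal C)=\emptyset$ or, recursively, there is a simplicial maximal subedge $\sigma$ such that the clutter obtained from $\mathcal C$ by removing all edges containing $\sigma$ is chordal. - Over a field $\mathbb K$, the edge ideal is $I(\mathcal C)=\big(\prod_{x\in e}x : e\in E(\mathcal C)\big)\subseteq \mathbb K[x : x\in V]$. It has a ($d$-)linear resolution if its graded Betti numbers satisfy $\beta_{i,j}(I(\mathcal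 C))=0$ whenever $j\ne i+d$. (The zero ideal satisfies this vacuously.) **Theorem.** Let $n\ge 3$, let $C_n$ be the cycle on $n$ vertices, and let $r\ge 2$. Then the clutter $\mathcal C_r(C_n)$ is chordal. Moreover, over every field $\mathbb K$, the edge ideal $I(\overline{\mathcal C_r(C_n)})$ has an $(r+1)$-linear resolution. -/

import Mathlib

open MvPolynomial

universe u v

/-- A `d`-uniform clutter on the vertex set `V`: a family of `d`-element subsets of `V`. (No edge
contains another one, since all edges have the same cardinality.) -/
@[ext]
structure UniformClutter (V : Type u) (d : ℕ) where
  /-- The edges of the clutter. -/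
  edges : Set (Finset V)
  card_eq : ∀ e ∈ edges, e.card = d

namespace UniformClutter

variable {V : Type u} {d : ℕ}

/-- The complement clutter: its edges are the `d`-subsets of `V` that are not edges of `C`. -/
def compl (C : UniformClutter V d) : UniformClutter V d where
  edges := {e | e.card = d ∧ e ∉ C.edges}
  card_eq := fun _ he => he.1

/-- `W` is a clique if every `d`-subset of `W` is an edge. -/
def IsClique (C : UniformClutter V d) (W : Set V) : Prop :=
  ∀ e : Finset V, e.card = d → (e : Set V) ⊆ W → e ∈ C.edges

/-- The closed neighborhood `N[σ] = σ ∪ {v | σ ∪ {v} is an edge}`. -/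
def closedNeighborhood [DecidableEq V] (C : UniformClutter V d) (σ : Finset V) : Set V :=
  (σ : Set V) ∪ {v | insert v σ ∈ C.edges}

/-- `σ` is a maximal subedge: a `(d - 1)`-subset of `V` with `N[σ] ≠ σ`. -/
def IsMaximalSubedge [DecidableEq V] (C : UniformClutter V d) (σ : Finset V) : Prop :=
  σ.card + 1 = d ∧ C.closedNeighborhood σ ≠ (σ : Set V)

/-- `σ` is a simplicial maximal subedge: a maximal subedge such that `N[σ]` is a clique. -/
def IsSimplicial [DecidableEq V] (C : UniformClutter V d) (σ : Finset V) : Prop :=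
  C.IsMaximalSubedge σ ∧ C.IsClique (C.closedNeighborhood σ)

/-- The deletion `C \ σ`: remove all edges that contain `σ`. -/
def delete (C : UniformClutter V d) (σ : Finset V) : UniformClutter V d where
  edges := {e | e ∈ C.edges ∧ ¬ σ ⊆ e}
  card_eq := fun e he => C.card_eq e he.1

/-- `C` is chordal if it has no edges, or if `C \ σ` is chordal for some simplicial maximal
subedge `σ` of `C`. -/
inductive IsChordal [DecidableEq V] : UniformClutter V d → Prop
  | of_edges_eq_empty (C : UniformClutter V d) (h : C.edges = ∅) : IsChordal C
  | of_delete (C : UniformClutter V d) (σ : Finset V) (hσ : C.IsSimplicial σ)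
      (h : IsChordal (C.delete σ)) : IsChordal C

/-- The edge ideal of a clutter over `K`: generated by the monomials `∏ x ∈ e, x` for edges `e`. -/
noncomputable def edgeIdeal (C : UniformClutter V d) (K : Type v) [Field K] :
    Ideal (MvPolynomial V K) :=
  Ideal.span {m | ∃ e ∈ C.edges, m = ∏ x ∈ e, X x}

end UniformClutter

/-- The `(r + 1)`-clutter of a graph: its edges are the `(r + 1)`-subsets `S` of the vertex set for
which the induced subgraph on `S` is connected. -/
def SimpleGraph.connectedClutter {V : Type u} (G : SimpleGraph V) (r : ℕ) :
    UniformClutter V (r + 1) where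
  edges := {S | S.card = r + 1 ∧ (G.induce (S : Set V)).Connected}
  card_eq := fun _ hS => hS.1

/-- A graded free resolution of finite length
`0 → F_p → ⋯ → F_1 → F_0 → I → 0` of an ideal `I` of the standard graded ring
`R = K[x_v | v ∈ V]`, where `F_i = ⨁_k R(-shift i k)`, with maps homogeneous of degree zero.
The map `F_{i+1} → F_i` is given by the matrix `diff i`, and `F_0 → I` sends the `k`-th basis
vector to `gen k`. -/
structure GradedFreeResolution {V : Type u} {K : Type v} [Field K]
    (I : Ideal (MvPolynomial V K)) where
  /-- The rank of `F_i`. -/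
  rank : ℕ → ℕ
  /-- The degree of the `k`-th basis vector of `F_i`. -/
  shift : (i : ℕ) → Fin (rank i) → ℕ
  /-- The images in `I` of the basis vectors of `F_0`. -/
  gen : Fin (rank 0) → MvPolynomial V K
  /-- The matrix of `F_{i+1} → F_i`. -/
  diff : (i : ℕ) → Matrix (Fin (rank i)) (Fin (rank (i + 1))) (MvPolynomial V K)
  gen_homogeneous : ∀ k, (gen k).IsHomogeneous (shift 0 k)
  diff_homogeneous : ∀ i a b, diff i a b = 0 ∨
    ∃ e, shift i a + e = shift (i + 1) b ∧ (diff i a b).IsHomogeneous e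
  finite_length : ∃ p, ∀ i, p < i → rank i = 0
  range_gen : LinearMap.range (Fintype.linearCombination (MvPolynomial V K) gen) = I
  exact_zero : Function.Exact (diff 0).mulVecLin
    (Fintype.linearCombination (MvPolynomial V K) gen)
  exact_succ : ∀ i, Function.Exact (diff (i + 1)).mulVecLin (diff i).mulVecLin

namespace GradedFreeResolution

variable {V : Type u} {K : Type v} [Field K] {I : Ideal (MvPolynomial V K)}

/-- The resolution is minimal: all entries of its matrices lie in the ideal generated by the
variables. -/
def IsMinimal (F : GradedFreeResolution I) : Prop :=
  ∀ i a b, F.diff i a b ∈ Ideal.span (Set.range (X : V → MvPolynomial V K))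

/-- The multiplicity of `R(-j)` in `F_i`; for a minimal resolution, the graded Betti number
`β_{i,j}(I)`. -/
def betti (F : GradedFreeResolution I) (i j : ℕ) : ℕ :=
  (Finset.univ.filter fun k => F.shift i k = j).card

end GradedFreeResolution

/-- `I` has a `d`-linear resolution: in its minimal graded free resolution (unique up to
isomorphism), `β_{i,j}(I) = 0` whenever `j ≠ i + d`. In particular `I` is generated in degree `d`. -/
def Ideal.HasLinearResolution {V : Type u} {K : Type v} [Field K]
    (I : Ideal (MvPolynomial V K)) (d : ℕ) : Prop :=
  ∃ F : GradedFreeResolution I, F.IsMinimal ∧ ∀ i j, j ≠ i + d → F.betti i j = 0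

/-! A nonempty vertex set of the cycle induces a connected subgraph exactly when it is an arc, so
the edges of the clutter are the arcs with `r + 1 ≥ 3` vertices, and the generators of the
complementary ideal are the non-arcs of that size.

Chordality: deletions only produce subclutters, so it suffices to find a simplicial subedge in every
nonempty subclutter. If at least two vertices lie outside an arc `e`, removing an inner vertex `m`
leaves a gap that no outside vertex repairs (`IsCycleArc.exists_not_isCycleArc_exchange`). Hence `e
\ {m}` lies in the single edge `e` and is simplicial. The case `n ≤ r + 2` is elementary.

Linear resolution: in decreasing colexicographic order the non-arcs have linear quotients. The
combinatorial core is the exchange lemma `exists_exchange_not_isCycleArc`. Adding a generator `f` to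
`J` when `J : f` is generated by variables glues the Koszul complex of those variables to a
resolution of `J`, as in a mapping cone, and keeps all syzygy matrices linear. Linear entries make
the resulting resolution minimal. -/

namespace MvPolynomial

/-! ### Linear complexes, the horseshoe lemma and mapping cones. -/

variable {V : Type u} {K : Type v} [Field K]

/-- Taking homogeneous components commutes with multiplication by a homogeneous polynomial. -/
theorem homogeneousComponent_add_mul {e : ℕ} {p : MvPolynomial V K} (hp : p.IsHomogeneous e)
    (n : ℕ) (q : MvPolynomial V K) :
    homogeneousComponent (e + n) (p * q) = p * homogeneousComponent n q := by
  let _ : GradedRing (homogeneousSubmodule V K) := gradedAlgebra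
  have h := DirectSum.coe_decompose_mul_add_of_left_mem (homogeneousSubmodule V K)
    (i := e) (j := n) (a := p) (b := q) hp
  rwa [← DirectSum.Decomposition.decompose'_eq, decomposition.decompose'_apply,
    decomposition.decompose'_apply] at h

/-- A submodule of a free module is graded if it is closed under homogeneous components. -/
def IsGradedSubmodule {ι : Type} (N : Submodule (MvPolynomial V K) (ι → MvPolynomial V K)) :
    Prop :=
  ∀ v ∈ N, ∀ n, (fun i => homogeneousComponent n (v i)) ∈ N

/-- Since all entries share one degree, no shifts are needed: the kernel is closed under taking
components of the same degree in every coordinate. -/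
theorem isGradedSubmodule_ker {ι κ : Type} [Fintype κ] {e : ℕ}
    (A : Matrix ι κ (MvPolynomial V K)) (hA : ∀ i k, (A i k).IsHomogeneous e) :
    IsGradedSubmodule (LinearMap.ker A.mulVecLin) := by
  intro v hv n
  rw [LinearMap.mem_ker, Matrix.mulVecLin_apply] at hv ⊢
  funext i
  have h := congrArg (homogeneousComponent (e + n)) (congrFun hv i)
  simp only [Matrix.mulVec, dotProduct, map_sum, Pi.zero_apply, map_zero] at h ⊢
  rw [← h]
  exact Finset.sum_congr rfl fun k _ => (homogeneousComponent_add_mul (hA i k) n _).symm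

/-- `HasLinearComplex p e M`: the submodule `M` of a free module is generated by vectors with
entries homogeneous of degree `e`, and it has a free resolution of length less than `p` all of
whose later matrices have linear entries. -/
def HasLinearComplex : (p e : ℕ) → {ι : Type} →
    Submodule (MvPolynomial V K) (ι → MvPolynomial V K) → Prop
  | 0, _, _, M => M = ⊥
  | p + 1, e, ι, M => ∃ (κ : Type) (_ : Fintype κ) (A : Matrix ι κ (MvPolynomial V K)),
      (∀ i k, (A i k).IsHomogeneous e) ∧ LinearMap.range A.mulVecLin = M ∧
        HasLinearComplex p 1 (LinearMap.ker A.mulVecLin)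

theorem hasLinearComplex_bot (p e : ℕ) {ι : Type} :
    HasLinearComplex p e (⊥ : Submodule (MvPolynomial V K) (ι → MvPolynomial V K)) := by
  induction p generalizing e ι with
  | zero => rfl
  | succ p ih =>
    refine ⟨Empty, inferInstance, fun _ k => k.elim, fun _ k => k.elim, ?_, ?_⟩
    · rw [LinearMap.range_eq_bot]
      exact Subsingleton.elim _ _
    · convert ih 1 using 1
      exact Subsingleton.elim _ _

theorem HasLinearComplex.succ {p e : ℕ} {ι : Type}
    {M : Submodule (MvPolynomial V K) (ι → MvPolynomial V K)} (h : HasLinearComplex p e M) :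
    HasLinearComplex (p + 1) e M := by
  induction p generalizing e ι with
  | zero =>
    obtain rfl : M = ⊥ := h
    exact hasLinearComplex_bot _ _
  | succ p ih =>
    obtain ⟨κ, _, A, hA, hr, hk⟩ := h
    exact ⟨κ, _, A, hA, hr, ih hk⟩

theorem HasLinearComplex.mono {p q e : ℕ} {ι : Type}
    {M : Submodule (MvPolynomial V K) (ι → MvPolynomial V K)} (h : HasLinearComplex p e M)
    (hpq : p ≤ q) : HasLinearComplex q e M := by
  induction q, hpq using Nat.le_induction with
  | base => exact h
  | succ q _ ih => exact ih.succ

/-- The horseshoe lemma for linear complexes. -/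
theorem HasLinearComplex.extension {p e : ℕ} {ι ι' : Type}
    {M : Submodule (MvPolynomial V K) (ι → MvPolynomial V K)}
    {M' : Submodule (MvPolynomial V K) (ι' → MvPolynomial V K)}
    {N : Submodule (MvPolynomial V K) (ι ⊕ ι' → MvPolynomial V K)}
    (hM : HasLinearComplex p e M) (hM' : HasLinearComplex p e M') (hN : IsGradedSubmodule N)
    (hinl : ∀ v, Sum.elim v (0 : ι' → MvPolynomial V K) ∈ N ↔ v ∈ M)
    (hinr : ∀ w, w ∈ M' ↔ ∃ v, Sum.elim v w ∈ N) :
    HasLinearComplex p e N := by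
  induction p generalizing e ι ι' with
  | zero =>
    obtain rfl : M = ⊥ := hM
    obtain rfl : M' = ⊥ := hM'
    refine (Submodule.eq_bot_iff _).2 fun v hv => ?_
    rw [← Sum.elim_comp_inl_inr v] at hv ⊢
    have h := (hinr _).2 ⟨_, hv⟩
    rw [Submodule.mem_bot] at h
    rw [h, hinl, Submodule.mem_bot] at hv
    rw [h, hv]
    exact Sum.elim_zero_zero
  | succ p ih =>
    obtain ⟨κ, _, A, hA, rfl, hAk⟩ := hM
    obtain ⟨κ', _, B, hB, rfl, hBk⟩ := hM'
    classical
    -- Each column of `B` lifts to `N`. Its degree `e` component is still a lift because `N` is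
    -- graded, so the corner block of `D` is homogeneous of degree `e`.
    have hlift : ∀ k, ∃ c : ι → MvPolynomial V K, (∀ i, (c i).IsHomogeneous e) ∧
        Sum.elim c (fun i => B i k) ∈ N := by
      intro k
      obtain ⟨c, hc⟩ := (hinr (fun i => B i k)).1
        ⟨Pi.single k 1, by ext1 i; simp⟩
      refine ⟨fun i => homogeneousComponent e (c i),
        fun i => homogeneousComponent_isHomogeneous e _, ?_⟩
      convert hN _ hc e using 1
      ext1 i
      rcases i with i | i
      · rfl
      · exact (homogeneousComponent_eq_self (hB i k)).symm
    choose C hC hCN using hlift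
    set D : Matrix (ι ⊕ ι') (κ ⊕ κ') (MvPolynomial V K) :=
      Matrix.fromBlocks A (Matrix.of fun i k => C k i) 0 B with hD
    have hDapp : ∀ v w, D.mulVec (Sum.elim v w) =
        Sum.elim (A.mulVec v + (Matrix.of fun i k => C k i).mulVec w) (B.mulVec w) := by
      intro v w
      rw [hD, Matrix.fromBlocks_mulVec]
      simp
    have hDe : ∀ i k, (D i k).IsHomogeneous e := by
      rintro (i | i) (k | k)
      · exact hA i k
      · exact hC k i
      · exact isHomogeneous_zero _ _ _
      · exact hB i k
    have hCmem : ∀ w, Sum.elim ((Matrix.of fun i k => C k i).mulVec w) (B.mulVec w) ∈ N := by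
      intro w
      have : Sum.elim ((Matrix.of fun i k => C k i).mulVec w) (B.mulVec w) =
          ∑ k, w k • Sum.elim (C k) (fun i => B i k) := by
        ext1 i
        rcases i with i | i <;>
          simp [Matrix.mulVec, dotProduct, Finset.sum_apply, mul_comm]
      rw [this]
      exact N.sum_mem fun k _ => N.smul_mem _ (hCN k)
    have hsub : ∀ (a b : ι → MvPolynomial V K) (w : ι' → MvPolynomial V K),
        Sum.elim a w - Sum.elim b w = Sum.elim (a - b) 0 := by
      intro a b w
      ext1 i
      rcases i with i | i <;> simp
    have hadd : ∀ (a b : ι → MvPolynomial V K) (w : ι' → MvPolynomial V K),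
        Sum.elim (a + b) w = Sum.elim a 0 + Sum.elim b w := by
      intro a b w
      ext1 i
      rcases i with i | i <;> simp
    refine ⟨κ ⊕ κ', inferInstance, D, hDe, ?_, ih hAk hBk (isGradedSubmodule_ker D hDe) ?_ ?_⟩
    · apply le_antisymm
      · rintro _ ⟨x, rfl⟩
        rw [Matrix.mulVecLin_apply, ← Sum.elim_comp_inl_inr x, hDapp, hadd]
        exact N.add_mem ((hinl _).2 ⟨_, rfl⟩) (hCmem _)
      · intro x hx
        rw [← Sum.elim_comp_inl_inr x] at hx ⊢
        obtain ⟨w, hw⟩ := (hinr _).2 ⟨_, hx⟩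
        rw [Matrix.mulVecLin_apply] at hw
        rw [← hw] at hx ⊢
        have h := N.sub_mem hx (hCmem w)
        rw [hsub, hinl] at h
        obtain ⟨v, hv⟩ := h
        refine ⟨Sum.elim v w, ?_⟩
        rw [Matrix.mulVecLin_apply] at hv ⊢
        rw [hDapp, hv, sub_add_cancel]
    · intro v
      simp only [LinearMap.mem_ker, Matrix.mulVecLin_apply, hDapp, Matrix.mulVec_zero, add_zero]
      refine ⟨fun h => ?_, fun h => by rw [h]; exact Sum.elim_zero_zero⟩
      funext i
      exact congrFun h (Sum.inl i)
    -- Surjectivity of `ker D → ker B`: if `B w = 0`, the lift of `w` lands in `M = range A`, so a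
    -- correction `-v` kills it.
    · intro w
      simp only [LinearMap.mem_ker, Matrix.mulVecLin_apply, hDapp]
      constructor
      · intro hw
        have h := hCmem w
        rw [hw, hinl] at h
        obtain ⟨v, hv⟩ := h
        rw [Matrix.mulVecLin_apply] at hv
        refine ⟨-v, ?_⟩
        rw [Matrix.mulVec_neg, hv, hw, neg_add_cancel]
        exact Sum.elim_zero_zero
      · rintro ⟨v, hv⟩
        funext i
        exact congrFun hv (Sum.inr i)

/-- An ideal as a submodule of the free module of rank one. -/
noncomputable def idealSubmodule (I : Ideal (MvPolynomial V K)) :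
    Submodule (MvPolynomial V K) (Unit → MvPolynomial V K) :=
  Submodule.comap (LinearMap.proj ()) I

theorem mem_idealSubmodule {I : Ideal (MvPolynomial V K)} {v : Unit → MvPolynomial V K} :
    v ∈ idealSubmodule I ↔ v () ∈ I := Iff.rfl

/-- Adding a generator `f` with `J : f` linear preserves linearity. -/
theorem HasLinearComplex.sup_span_singleton {p d : ℕ} {J L : Ideal (MvPolynomial V K)}
    {f : MvPolynomial V K} (hf : f.IsHomogeneous d)
    (hJ : HasLinearComplex (p + 1) d (idealSubmodule J))
    (hL : HasLinearComplex p 1 (idealSubmodule L)) (hcolon : ∀ c, c ∈ L ↔ c * f ∈ J) :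
    HasLinearComplex (p + 1) d (idealSubmodule (J ⊔ Ideal.span {f})) := by
  obtain ⟨κ, _, A, hA, hr, hk⟩ := hJ
  have hJmem : ∀ x : MvPolynomial V K, x ∈ J ↔ ∃ v, A.mulVec v () = x := by
    intro x
    have : x ∈ J ↔ (fun _ => x) ∈ idealSubmodule J := Iff.rfl
    rw [this, ← hr]
    constructor
    · rintro ⟨v, hv⟩
      exact ⟨v, congrFun hv ()⟩
    · rintro ⟨v, hv⟩
      exact ⟨v, _root_.funext fun _ => hv⟩
  -- The syzygies of `(A | f)` form an extension of `L = J : f` by the syzygies of `A`, so the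
  -- horseshoe lemma applies.
  set D : Matrix Unit (κ ⊕ Unit) (MvPolynomial V K) :=
    Matrix.fromCols A (Matrix.of fun _ _ => f) with hD
  have hDapp : ∀ v w, D.mulVec (Sum.elim v w) () = A.mulVec v () + w () * f := by
    intro v w
    rw [hD, Matrix.fromCols_mulVec]
    simp [Matrix.mulVec, dotProduct, mul_comm]
  have hDe : ∀ i k, (D i k).IsHomogeneous d := by
    rintro i (k | k)
    · exact hA i k
    · exact hf
  have hker : ∀ v w, Sum.elim v w ∈ LinearMap.ker D.mulVecLin ↔ A.mulVec v () + w () * f = 0 := by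
    intro v w
    rw [LinearMap.mem_ker, Matrix.mulVecLin_apply, ← hDapp]
    exact ⟨fun h => congrFun h (), fun h => _root_.funext fun _ => h⟩
  refine ⟨κ ⊕ Unit, inferInstance, D, hDe, ?_,
    hk.extension hL (isGradedSubmodule_ker D hDe) ?_ ?_⟩
  · ext x
    rw [mem_idealSubmodule, sup_comm, Ideal.mem_span_singleton_sup]
    constructor
    · rintro ⟨v, rfl⟩
      rw [← Sum.elim_comp_inl_inr v, Matrix.mulVecLin_apply, hDapp, add_comm]
      exact ⟨_, _, (hJmem _).2 ⟨_, rfl⟩, rfl⟩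
    · rintro ⟨a, b, hb, hab⟩
      obtain ⟨v, rfl⟩ := (hJmem b).1 hb
      refine ⟨Sum.elim v fun _ => a, _root_.funext fun _ => ?_⟩
      rw [Matrix.mulVecLin_apply, hDapp, add_comm]
      exact hab
  · intro v
    rw [hker, LinearMap.mem_ker, Matrix.mulVecLin_apply]
    simp only [Pi.zero_apply, zero_mul, add_zero]
    exact ⟨fun h => _root_.funext fun _ => h, fun h => congrFun h ()⟩
  · intro w
    rw [mem_idealSubmodule, hcolon, hJmem]
    constructor
    · rintro ⟨v, hv⟩
      refine ⟨-v, (hker _ _).2 ?_⟩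
      rw [Matrix.mulVec_neg, Pi.neg_apply, hv, neg_add_cancel]
    · rintro ⟨v, hv⟩
      refine ⟨-v, ?_⟩
      rw [Matrix.mulVec_neg, Pi.neg_apply]
      exact neg_eq_of_add_eq_zero_right ((hker _ _).1 hv)

/-- This is the Koszul complex: a variable outside `S` is a nonzerodivisor modulo the variables of
`S`, so the colon ideal is the ideal already built and the induction hypothesis serves twice. -/
theorem hasLinearComplex_span_X (S : Finset V) :
    HasLinearComplex S.card 1
      (idealSubmodule (Ideal.span (X '' (S : Set V) : Set (MvPolynomial V K)))) := by
  classical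
  induction S using Finset.induction_on with
  | empty =>
    refine (Submodule.eq_bot_iff _).2 fun v hv => _root_.funext fun _ => ?_
    rw [mem_idealSubmodule] at hv
    simpa using hv
  | insert a S ha ih =>
    rw [Finset.card_insert_of_notMem ha, Finset.coe_insert, Set.image_insert_eq,
      Ideal.span_insert, sup_comm]
    refine ih.succ.sup_span_singleton (isHomogeneous_X K a) ih fun c => ?_
    refine ⟨fun h => Ideal.mul_mem_right _ _ h, fun h => ?_⟩
    rw [mem_ideal_span_X_image] at h ⊢
    intro m hm
    obtain ⟨i, hi, him⟩ := h (m + Finsupp.single a 1) (by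
      rw [mem_support_iff, coeff_mul_X]
      exact mem_support_iff.1 hm)
    refine ⟨i, hi, ?_⟩
    have hai : a ≠ i := by
      rintro rfl
      exact ha hi
    simpa [hai] using him

/-! ### Squarefree monomial ideals with linear quotients. -/

/-- The exponent of a squarefree monomial. -/
noncomputable def squarefreeExponent (e : Finset V) : V →₀ ℕ := ∑ x ∈ e, Finsupp.single x 1

theorem squarefreeExponent_apply [DecidableEq V] (e : Finset V) (x : V) :
    squarefreeExponent e x = if x ∈ e then 1 else 0 := by
  simp [squarefreeExponent, Finsupp.finsetSum_apply, Finsupp.single_apply]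

theorem prod_X_eq_monomial (e : Finset V) :
    (∏ x ∈ e, X x : MvPolynomial V K) = monomial (squarefreeExponent e) 1 :=
  (monomial_sum_one e _).symm

theorem isHomogeneous_prod_X (e : Finset V) :
    (∏ x ∈ e, X x : MvPolynomial V K).IsHomogeneous e.card := by
  simpa using IsHomogeneous.prod e (X : V → MvPolynomial V K) (fun _ => 1)
    fun x _ => isHomogeneous_X K x

/-- A squarefree monomial ideal whose generators have the same degree and admit linear quotients
has a linear resolution. -/
theorem exists_hasLinearComplex_of_linear_quotients [Finite V] [DecidableEq V] {β : Type*}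
    [LinearOrder β] (f : Finset V → β) (hf : Function.Injective f) {d : ℕ} (E : Finset (Finset V))
    (hE : ∀ e ∈ E, e.card = d)
    (hq : ∀ u ∈ E, ∀ v ∈ E, f v < f u →
      ∃ x ∈ v, x ∉ u ∧ ∃ w ∈ E, f w < f u ∧ w ⊆ insert x u) :
    ∃ p, HasLinearComplex p d (idealSubmodule (Ideal.span
      ((fun e => ∏ x ∈ e, X x) '' (E : Set (Finset V)) : Set (MvPolynomial V K)))) := by
  induction E using Finset.induction_on_max_value f with
  | empty =>
    refine ⟨0, (Submodule.eq_bot_iff _).2 fun v hv => _root_.funext fun _ => ?_⟩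
    rw [mem_idealSubmodule] at hv
    simpa using hv
  | insert a s ha hmax ih =>
    have hlt : ∀ u ∈ s, ∀ w ∈ insert a s, f w < f u → w ∈ s := by
      intro u hu w hw h
      rcases Finset.mem_insert.1 hw with rfl | hw
      · exact absurd (hmax u hu) (not_le.2 h)
      · exact hw
    obtain ⟨p, hp⟩ := ih (fun e he => hE e (Finset.mem_insert_of_mem he))
      fun u hu v hv huv => by
        obtain ⟨x, hx, hxu, w, hw, hwu, hsub⟩ :=
          hq u (Finset.mem_insert_of_mem hu) v (Finset.mem_insert_of_mem hv) huv
        exact ⟨x, hx, hxu, w, hlt u hu w hw hwu, hwu, hsub⟩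
    -- These variables generate the colon ideal of the earlier generators by the last generator `a`;
    -- both inclusions are checked on monomials.
    let L : Finset V := {x : V | x ∉ a ∧ ∃ w ∈ s, w ⊆ insert x a}.toFinite.toFinset
    have hL : ∀ x, x ∈ L ↔ x ∉ a ∧ ∃ w ∈ s, w ⊆ insert x a := fun x => by simp [L]
    refine ⟨p + L.card + 1, ?_⟩
    rw [Finset.coe_insert, Set.image_insert_eq, Ideal.span_insert, sup_comm]
    refine (hp.mono (by omega)).sup_span_singleton
      (hE a (Finset.mem_insert_self _ _) ▸ isHomogeneous_prod_X a)
      ((hasLinearComplex_span_X L).mono (by omega)) fun c => ?_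
    have himage : ((fun e => ∏ x ∈ e, X x) '' (s : Set (Finset V)) : Set (MvPolynomial V K)) =
        (fun m => monomial m 1) '' (squarefreeExponent '' (s : Set (Finset V))) := by
      rw [Set.image_image]
      exact Set.image_congr fun e _ => prod_X_eq_monomial e
    rw [himage, mem_ideal_span_X_image, mem_ideal_span_monomial_image, prod_X_eq_monomial]
    constructor
    · intro h m hm
      rw [mem_support_iff, coeff_mul_monomial'] at hm
      split_ifs at hm with hle
      · obtain ⟨i, hi, hmi⟩ := h (m - squarefreeExponent a) (by
          rw [mem_support_iff]
          exact left_ne_zero_of_mul hm)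
        obtain ⟨-, w, hw, hsub⟩ := (hL i).1 hi
        refine ⟨_, ⟨w, hw, rfl⟩, fun y => ?_⟩
        have hy := hle y
        rw [squarefreeExponent_apply] at hy ⊢
        rw [Finsupp.tsub_apply] at hmi
        split_ifs with hyw
        · rcases Finset.mem_insert.1 (hsub hyw) with rfl | hya
          · omega
          · rw [if_pos hya] at hy
            exact hy
        · exact Nat.zero_le _
      · exact absurd rfl hm
    · intro h m hm
      obtain ⟨_, ⟨v, hv, rfl⟩, hle⟩ := h (m + squarefreeExponent a) (by
        rw [mem_support_iff, coeff_mul_monomial, mul_one]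
        exact mem_support_iff.1 hm)
      obtain ⟨x, hx, hxa, w, hw, hwa, hsub⟩ := hq a (Finset.mem_insert_self _ _) v
        (Finset.mem_insert_of_mem hv) (lt_of_le_of_ne (hmax v hv) fun h => ha (hf h ▸ hv))
      refine ⟨x, (hL x).2 ⟨hxa, w, ?_, hsub⟩, ?_⟩
      · rcases Finset.mem_insert.1 hw with rfl | hw
        · exact absurd hwa (lt_irrefl _)
        · exact hw
      · have := hle x
        rw [Finsupp.add_apply, squarefreeExponent_apply, squarefreeExponent_apply, if_pos hx,
          if_neg hxa] at this
        omega

end MvPolynomial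

/-! ### From linear complexes to minimal graded free resolutions. -/

namespace MvPolynomial

variable {V : Type u} {K : Type v} [Field K]

/-- A matrix with linear entries (or the matrix of generators) of a linear complex, together with
a bound on the length of the rest of the complex. -/
structure LinearComplexStage (V : Type u) (K : Type v) [Field K] where
  row : Type
  col : Type
  [rowFintype : Fintype row]
  [colFintype : Fintype col]
  bound : ℕ
  mat : Matrix row col (MvPolynomial V K)
  kernel : HasLinearComplex bound 1 (LinearMap.ker mat.mulVecLin)

attribute [instance] LinearComplexStage.rowFintype LinearComplexStage.colFintype

namespace LinearComplexStage

/-- The nested existentials of `HasLinearComplex` are unfolded one matrix at a time, so that choice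
yields an infinite sequence; once the bound is `0`, the sequence continues with zero modules. -/
theorem exists_next (s : LinearComplexStage V K) :
    ∃ (κ : Type) (_ : Fintype κ) (A : Matrix s.col κ (MvPolynomial V K)),
      (∀ i k, (A i k).IsHomogeneous 1) ∧
        LinearMap.range A.mulVecLin = LinearMap.ker s.mat.mulVecLin ∧
        HasLinearComplex (s.bound - 1) 1 (LinearMap.ker A.mulVecLin) ∧
        (s.bound = 0 → IsEmpty κ) := by
  obtain ⟨row, col, b, A, hA⟩ := s
  cases b with
  | zero =>
    refine ⟨Empty, inferInstance, fun _ k => k.elim, fun _ k => k.elim, ?_, ?_,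
      fun _ => inferInstance⟩
    · have hA' : LinearMap.ker A.mulVecLin = ⊥ := hA
      change _ = LinearMap.ker A.mulVecLin
      rw [hA', LinearMap.range_eq_bot]
      exact Subsingleton.elim _ _
    · exact Subsingleton.elim _ _
  | succ b =>
    obtain ⟨κ, _, B, hB, hr, hk⟩ := hA
    exact ⟨κ, _, B, hB, hr, hk, fun h => absurd h (Nat.succ_ne_zero b)⟩

/-- The next matrix of the complex. -/
noncomputable def next (s : LinearComplexStage V K) : LinearComplexStage V K where
  row := s.col
  col := s.exists_next.choose
  rowFintype := s.colFintype
  colFintype := s.exists_next.choose_spec.choose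
  bound := s.bound - 1
  mat := s.exists_next.choose_spec.choose_spec.choose
  kernel := s.exists_next.choose_spec.choose_spec.choose_spec.2.2.1

theorem next_isHomogeneous (s : LinearComplexStage V K) (i k) :
    (s.next.mat i k).IsHomogeneous 1 :=
  s.exists_next.choose_spec.choose_spec.choose_spec.1 i k

theorem range_next (s : LinearComplexStage V K) :
    LinearMap.range (show Matrix s.col s.next.col (MvPolynomial V K) from s.next.mat).mulVecLin =
      LinearMap.ker s.mat.mulVecLin :=
  s.exists_next.choose_spec.choose_spec.choose_spec.2.1

theorem isEmpty_col_next (s : LinearComplexStage V K) (h : s.bound = 0) : IsEmpty s.next.col :=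
  s.exists_next.choose_spec.choose_spec.choose_spec.2.2.2 h

/-- The `i`-th matrix of the complex that starts with `s`. -/
noncomputable def iter (s : LinearComplexStage V K) : ℕ → LinearComplexStage V K
  | 0 => s
  | i + 1 => (s.iter i).next

theorem bound_iter (s : LinearComplexStage V K) (i : ℕ) : (s.iter i).bound = s.bound - i := by
  induction i with
  | zero => rfl
  | succ i ih =>
    change (s.iter i).bound - 1 = _
    omega

end LinearComplexStage

theorem exact_submatrix {l m n : Type} [Fintype l] [Fintype m] [Fintype n] {l' m' n' : Type}
    [Fintype l'] [Fintype m'] [Fintype n'] {A : Matrix l m (MvPolynomial V K)}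
    {B : Matrix m n (MvPolynomial V K)} (h : Function.Exact B.mulVecLin A.mulVecLin)
    (e₁ : l' ≃ l) (e₂ : m' ≃ m) (e₃ : n' ≃ n) :
    Function.Exact (B.submatrix e₂ e₃).mulVecLin (A.submatrix e₁ e₂).mulVecLin := by
  intro y
  have hy := h (y ∘ e₂.symm)
  simp only [Matrix.mulVecLin_apply, Matrix.submatrix_mulVec_equiv, Set.mem_range] at hy ⊢
  constructor
  · intro h0
    obtain ⟨z, hz⟩ := hy.1 (by
      ext1 i
      simpa using congrFun h0 (e₁.symm i))
    refine ⟨z ∘ e₃, ?_⟩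
    ext1 i
    simpa [Function.comp_assoc] using congrFun hz (e₂ i)
  · rintro ⟨z, hz⟩
    have h0 := hy.2 ⟨z ∘ e₃.symm, by
      ext1 i
      simpa using congrFun hz (e₂.symm i)⟩
    rw [h0]
    rfl

theorem mem_span_range_X_of_isHomogeneous_one {p : MvPolynomial V K} (hp : p.IsHomogeneous 1) :
    p ∈ Ideal.span (Set.range (X : V → MvPolynomial V K)) := by
  rw [← Set.image_univ, mem_ideal_span_X_image]
  intro m hm
  by_contra! h
  have h0 : m = 0 := Finsupp.ext fun i => h i (Set.mem_univ i)
  have h1 := hp (mem_support_iff.1 hm)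
  rw [h0] at h1
  simp at h1

theorem HasLinearComplex.hasLinearResolution {p d : ℕ} {I : Ideal (MvPolynomial V K)}
    (h : HasLinearComplex p d (idealSubmodule I)) : I.HasLinearResolution d := by
  -- The extra step supplies a matrix of generators even for `p = 0`, where the ideal is zero.
  obtain ⟨κ, _, A, hA, hr, hk⟩ := h.succ
  let s : LinearComplexStage V K := ⟨Unit, κ, p, A, hk⟩
  let e : ∀ i, Fin (Fintype.card (s.iter i).col) ≃ (s.iter i).col :=
    fun i => (Fintype.equivFin _).symm
  let D : ∀ i, Matrix (s.iter i).col (s.iter (i + 1)).col (MvPolynomial V K) :=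
    fun i => (s.iter i).next.mat
  have hD : ∀ i a b, (D i a b).IsHomogeneous 1 := fun i => (s.iter i).next_isHomogeneous
  have hexact : ∀ i, LinearMap.range (D i).mulVecLin = LinearMap.ker (s.iter i).mat.mulVecLin :=
    fun i => (s.iter i).range_next
  let A' : Matrix Unit (s.iter 0).col (MvPolynomial V K) := A
  have hlc : ∀ v, Fintype.linearCombination (MvPolynomial V K) (fun k => A () (e 0 k)) v =
      (A'.submatrix (Equiv.refl Unit) (e 0)).mulVecLin v () := by
    intro v
    simp [Fintype.linearCombination_apply, Matrix.mulVec, dotProduct, A', mul_comm]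
    rfl
  refine ⟨{
    rank := fun i => Fintype.card (s.iter i).col
    shift := fun i _ => i + d
    gen := fun k => A () (e 0 k)
    diff := fun i => (D i).submatrix (e i) (e (i + 1))
    gen_homogeneous := fun k => by
      rw [Nat.zero_add]
      exact hA _ _
    diff_homogeneous := fun i a b => Or.inr ⟨1, by omega, hD i _ _⟩
    finite_length := ⟨p, fun i hi => ?_⟩
    range_gen := ?_
    exact_zero := ?_
    exact_succ := fun i => ?_ }, ?_, ?_⟩
  · obtain ⟨j, rfl⟩ : ∃ j, i = j + 1 := ⟨i - 1, by omega⟩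
    rw [Fintype.card_eq_zero_iff]
    refine (s.iter j).isEmpty_col_next ?_
    rw [s.bound_iter]
    exact Nat.sub_eq_zero_of_le (Nat.lt_succ_iff.1 hi)
  · ext x
    have hx : x ∈ I ↔ (fun _ => x) ∈ idealSubmodule I := Iff.rfl
    rw [hx, ← hr]
    constructor
    · rintro ⟨v, rfl⟩
      rw [hlc, Matrix.mulVecLin_apply, Matrix.submatrix_mulVec_equiv]
      exact ⟨v ∘ (e 0).symm, rfl⟩
    · rintro ⟨v, hv⟩
      refine ⟨v ∘ e 0, ?_⟩
      rw [hlc, Matrix.mulVecLin_apply, Matrix.submatrix_mulVec_equiv]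
      have hve : (v ∘ e 0) ∘ (e 0).symm = v :=
        _root_.funext fun k => congrArg v ((e 0).apply_symm_apply k)
      rw [hve]
      exact congrFun hv ()
  · have h0 : Function.Exact (D 0).mulVecLin A'.mulVecLin :=
      LinearMap.exact_iff.2 (hexact 0).symm
    intro v
    rw [hlc, ← exact_submatrix h0 (Equiv.refl Unit) (e 0) (e 1) v]
    exact ⟨fun h => _root_.funext fun _ => h, fun h => congrFun h ()⟩
  · exact exact_submatrix (LinearMap.exact_iff.2 (hexact (i + 1)).symm) _ _ _
  · exact fun i a b => mem_span_range_X_of_isHomogeneous_one (hD i _ _)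
  · intro i j hij
    rw [GradedFreeResolution.betti, Finset.card_eq_zero, Finset.filter_eq_empty_iff]
    exact fun _ _ h => hij h.symm

end MvPolynomial

/-! ### Arcs of the cycle and the exchange property of non-arcs. -/

/-- A set of vertices of the cycle `0, 1, …, n - 1` is an arc if it or its complement is an
interval. -/
def Finset.IsCycleArc {n : ℕ} (S : Finset (Fin n)) : Prop :=
  (∀ a b c, a < b → b < c → a ∈ S → c ∈ S → b ∈ S) ∨
    ∀ a b c, a < b → b < c → a ∉ S → c ∉ S → b ∉ S

namespace Finset

variable {n : ℕ}

/-- If every such exchange gave an arc, then `v` or `u` would be an arc, or some exchanged set would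
alternate in, out, in, out around the cycle. The cases are 0, 1 or at least 2 elements of `v` below
`x`, the largest element where `u` and `v` differ. -/
theorem exists_exchange_not_isCycleArc {u v : Finset (Fin n)} (hcard : u.card = v.card)
    (h3 : 3 ≤ u.card) (hu : ¬ u.IsCycleArc) (hv : ¬ v.IsCycleArc) {x : Fin n} (hxv : x ∈ v)
    (hxu : x ∉ u) (hx : ∀ b, x < b → (b ∈ u ↔ b ∈ v)) :
    ∃ z ∈ v, z ∉ u ∧ ∃ y ∈ u, y < z ∧ ¬ ((insert z u).erase y).IsCycleArc := by
  by_contra! H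
  -- The sets agree above `x`, and only `v` contains `x`; equal cardinalities leave `u` one more
  -- element below.
  have hlow : (u.filter (· < x)).card = (v.filter (· < x)).card + 1 := by
    have h1 := Finset.card_filter_add_card_filter_not (s := u) (· < x)
    have h2 := Finset.card_filter_add_card_filter_not (s := v) (· < x)
    have h3 : v.filter (fun b => ¬ b < x) = insert x (u.filter (fun b => ¬ b < x)) := by
      ext b
      simp only [mem_filter, mem_insert, not_lt]
      constructor
      · rintro ⟨h, h'⟩
        rcases h'.eq_or_lt with rfl | h'
        · exact Or.inl rfl
        · exact Or.inr ⟨(hx b h').2 h, h'.le⟩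
      · rintro (rfl | ⟨h, h'⟩)
        · exact ⟨hxv, le_rfl⟩
        · refine ⟨(hx b (lt_of_le_of_ne h' ?_)).1 h, h'⟩
          rintro rfl
          exact hxu h
    rw [h3, Finset.card_insert_of_notMem (by simp [hxu])] at h2
    omega
  have Hx := H x hxv hxu
  rcases Nat.lt_or_ge (v.filter (· < x)).card 2 with hlt | hge
  · rcases Nat.lt_or_ge (v.filter (· < x)).card 1 with hlt0 | hge1
    · have hv0 : ∀ b ∈ v, ¬ b < x := by
        have : v.filter (· < x) = ∅ := Finset.card_eq_zero.1 (by omega)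
        simpa [Finset.filter_eq_empty_iff] using this
      obtain ⟨y, hy⟩ := Finset.card_eq_one.1 (show (u.filter (· < x)).card = 1 by omega)
      have hy' : ∀ b, b ∈ u ∧ b < x ↔ b = y := by
        intro b; rw [← Finset.mem_filter (p := (· < x)), hy, Finset.mem_singleton]
      -- Exchanging the only element of `u` below `x` for `x` gives `v` itself.
      apply hv
      convert Hx y ((hy' y).2 rfl).1 ((hy' y).2 rfl).2 using 1
      ext b
      rw [Finset.mem_erase, Finset.mem_insert]
      rcases lt_trichotomy b x with h | h | h <;> grind
    · obtain ⟨z, hz⟩ := Finset.card_eq_one.1 (show (v.filter (· < x)).card = 1 by omega)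
      obtain ⟨y₁, y₂, hy12, hy⟩ := Finset.card_eq_two.1 (show (u.filter (· < x)).card = 2 by omega)
      wlog hlt12 : y₁ < y₂ generalizing y₁ y₂
      · exact this y₂ y₁ hy12.symm (by rw [hy, Finset.pair_comm])
          (lt_of_le_of_ne (not_lt.1 hlt12) hy12.symm)
      have hz' : ∀ b, b ∈ v ∧ b < x ↔ b = z := by
        intro b; rw [← Finset.mem_filter (p := (· < x)), hz, Finset.mem_singleton]
      have hy' : ∀ b, b ∈ u ∧ b < x ↔ b = y₁ ∨ b = y₂ := by
        intro b; rw [← Finset.mem_filter (p := (· < x)), hy]; simp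
      obtain ⟨t, htu, htx⟩ : ∃ t ∈ u, x < t := by
        by_contra! h
        have : u.filter (· < x) = u := Finset.filter_true_of_mem fun b hb =>
          lt_of_le_of_ne (h b hb) fun h => hxu (h ▸ hb)
        rw [this] at hy
        rw [hy, Finset.card_pair hy12] at h3
        omega
      obtain ⟨hzv, hzx⟩ := (hz' z).2 rfl
      obtain ⟨hy1u, hy1x⟩ := (hy' y₁).2 (Or.inl rfl)
      obtain ⟨hy2u, hy2x⟩ := (hy' y₂).2 (Or.inr rfl)
      have hA1 := Hx y₁ hy1u hy1x
      have hA2 := Hx y₂ hy2u hy2x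
      have hzne1 : z ≠ y₁ := by
        rintro rfl
        apply hv
        convert hA2 using 1
        ext b
        rw [Finset.mem_erase, Finset.mem_insert]
        rcases lt_trichotomy b x with h | h | h <;> grind
      have hzne2 : z ≠ y₂ := by
        rintro rfl
        apply hv
        convert hA1 using 1
        ext b
        rw [Finset.mem_erase, Finset.mem_insert]
        rcases lt_trichotomy b x with h | h | h <;> grind
      have hzu : z ∉ u := fun h => by
        rcases (hy' z).1 ⟨h, hzx⟩ with h | h
        · exact hzne1 h
        · exact hzne2 h
      have hyz : y₁ < z ∧ z < y₂ := by
        have c2 : ¬ z < y₁ := by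
          intro hlt
          rcases hA2 with h | h
          · have := h y₁ y₂ x hlt12 hy2x
            grind
          · have := h z y₁ y₂ hlt hlt12
            grind
        have c1 : ¬ y₂ < z := by
          intro hlt
          rcases hA1 with h | h
          · have := h y₂ z x hlt hzx
            grind
          · have := h y₁ y₂ z hlt12 hlt
            grind
        grind
      -- After exchanging `y₁` for `z`, the vertices `y₁, z, x, t` alternate out, in, out, in.
      have hA := H z hzv hzu y₁ hy1u hyz.1
      rcases hA with h | h
      · have := h y₂ x t hy2x htx
        grind
      · have := h y₁ z x hyz.1 hzx
        grind
  · obtain ⟨y₁, y₂, y₃, h12, h23, hsub⟩ : ∃ y₁ y₂ y₃, y₁ < y₂ ∧ y₂ < y₃ ∧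
        ∀ b, b = y₁ ∨ b = y₂ ∨ b = y₃ → b ∈ u ∧ b < x := by
      have h3 : 3 ≤ (u.filter (· < x)).card := by omega
      let f := (u.filter (· < x)).orderEmbOfFin rfl
      refine ⟨f ⟨0, by omega⟩, f ⟨1, by omega⟩, f ⟨2, by omega⟩, ?_, ?_, ?_⟩
      · exact f.strictMono (by simp)
      · exact f.strictMono (by simp)
      · intro b hb
        rw [← Finset.mem_filter (p := (· < x))]
        rcases hb with rfl | rfl | rfl <;> exact Finset.orderEmbOfFin_mem _ _ _
    obtain ⟨hy1u, hy1x⟩ := hsub y₁ (by simp)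
    obtain ⟨hy2u, hy2x⟩ := hsub y₂ (by simp)
    obtain ⟨hy3u, hy3x⟩ := hsub y₃ (by simp)
    have hA1 := Hx y₁ hy1u hy1x
    have hA2 := Hx y₂ hy2u hy2x
    have hA3 := Hx y₃ hy3u hy3x
    -- For any position of a missing vertex `z`, some exchange of a `yᵢ` for `x` has an alternating
    -- pattern. Thus `u` misses only `x` and is an arc.
    have hall : ∀ z, z ∈ insert x u := by
      by_contra! ⟨z, hz⟩
      have hzB : z ∉ u ∧ z ≠ x := by grind
      have c2 : y₁ < z ∧ z < y₃ := by
        rcases hA2 with h | h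
        · have := h y₁ y₂ x h12 hy2x
          grind
        · constructor
          · by_contra! hle
            have := h z y₁ y₂ (by grind) h12
            grind
          · by_contra! hle
            have := h y₂ y₃ z h23 (by grind)
            grind
      have c1 : z < y₂ := by
        by_contra! hle
        have hlt : y₂ < z := by grind
        rcases hA1 with h | h
        · have := h y₂ z y₃ hlt c2.2
          grind
        · have := h y₁ y₂ z h12 hlt
          grind
      rcases hA3 with h | h
      · have := h y₁ z y₂ c2.1 c1
        grind
      · have := h z y₂ y₃ c1 h23
        grind
    refine hu (Or.inr fun a b c hab hbc ha hc => ?_)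
    have h1 := hall a
    have h2 := hall c
    grind

end Finset

namespace SimpleGraph

theorem cycleGraph_adj_iff_val {n : ℕ} (hn : 2 ≤ n) {a b : Fin n} :
    (cycleGraph n).Adj a b ↔ a.val + 1 = b.val ∨ b.val + 1 = a.val ∨
      (a.val = 0 ∧ b.val + 1 = n) ∨ (b.val = 0 ∧ a.val + 1 = n) := by
  have ha := a.2
  have hb := b.2
  rw [cycleGraph_adj', Fin.val_sub, Fin.val_sub]
  rcases lt_trichotomy a.val b.val with h | h | h
  · rw [Nat.mod_eq_of_lt (show n - b.val + a.val < n by omega),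
      show n - a.val + b.val = (b.val - a.val) + n by omega, Nat.add_mod_right,
      Nat.mod_eq_of_lt (by omega)]
    omega
  · rw [h, Nat.sub_add_cancel (by omega), Nat.mod_self]
    omega
  · rw [Nat.mod_eq_of_lt (show n - a.val + b.val < n by omega),
      show n - b.val + a.val = (a.val - b.val) + n by omega, Nat.add_mod_right,
      Nat.mod_eq_of_lt (by omega)]
    omega

end SimpleGraph

/-! ### Inner vertices of arcs. -/

namespace Finset

variable {n : ℕ}

/-- An arc with at least three vertices has a vertex whose replacement by a new one never gives an
arc, if there are at least two vertices outside. -/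
theorem IsCycleArc.exists_not_isCycleArc_exchange {e : Finset (Fin n)} (he : e.IsCycleArc)
    (h3 : 3 ≤ e.card) (hn : e.card + 2 ≤ n) :
    ∃ m ∈ e, ∀ v, v ∉ e → ¬ (insert v (e.erase m)).IsCycleArc := by
  have houtside : ∀ v, ∃ q, q ∉ e ∧ q ≠ v := by
    intro v
    have hc : (eᶜ.erase v).Nonempty := by
      rw [← Finset.card_pos]
      have h1 := Finset.card_compl e
      have h2 := Finset.pred_card_le_card_erase (s := eᶜ) (a := v)
      rw [Fintype.card_fin] at h1
      omega
    obtain ⟨q, hq⟩ := hc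
    rw [Finset.mem_erase, Finset.mem_compl] at hq
    exact ⟨q, hq.2, hq.1⟩
  -- The inequalities say that `{s, t}` and `{m, q}` cross on the circle. With `s, t` kept, `m`
  -- removed and `q ≠ v` still missing, the new set is not an arc.
  suffices h : ∃ m ∈ e, ∀ q, q ∉ e → ∃ s ∈ e, ∃ t ∈ e, s ≠ m ∧ t ≠ m ∧
      ((s < m ∧ m < t ∧ (t < q ∨ q < s)) ∨ (s < q ∧ q < t ∧ (t < m ∨ m < s))) by
    obtain ⟨m, hm, h⟩ := h
    refine ⟨m, hm, fun v hv harc => ?_⟩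
    obtain ⟨q, hq, hqv⟩ := houtside v
    obtain ⟨s, hs, t, ht, hsm, htm, h⟩ := h q hq
    rcases harc with harc | harc
    · have h1 := harc s m t
      have h2 := harc s q t
      grind
    · have h1 := harc m t q
      have h2 := harc q s m
      have h3 := harc q t m
      have h4 := harc m s q
      grind
  let f := e.orderEmbOfFin rfl
  have hf : ∀ i, f i ∈ e := fun i => Finset.orderEmbOfFin_mem _ _ _
  have hflt : ∀ i j, i < j → f i < f j := fun i j h => f.strictMono h
  obtain ⟨a, b, c, hab, hbc, ha, hb, hc⟩ : ∃ a b c, a < b ∧ b < c ∧ a ∈ e ∧ b ∈ e ∧ c ∈ e :=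
    ⟨f ⟨0, by omega⟩, f ⟨1, by omega⟩, f ⟨2, by omega⟩, hflt _ _ (by simp), hflt _ _ (by simp),
      hf _, hf _, hf _⟩
  rcases he with he | he
  · refine ⟨b, hb, fun q hq => ⟨a, ha, c, hc, hab.ne, hbc.ne', Or.inl ⟨hab, hbc, ?_⟩⟩⟩
    have := he a q c
    grind
  · by_cases hgap : ∃ g, g ∉ e
    · obtain ⟨g, hg⟩ := hgap
      have hne : ∀ x ∈ e, x < g ∨ g < x := fun x hx => by
        rcases lt_trichotomy x g with h | h | h
        · exact Or.inl h
        · exact absurd hx (h ▸ hg)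
        · exact Or.inr h
      have hside : ∀ q, q ∉ e → ∀ x ∈ e, (x < g → x < q) ∧ (g < x → q < x) := by
        intro q hq x hx
        have h1 := he q x g
        have h2 := he g x q
        grind
      -- The vertex `m` is the middle one of `a, b, c` in cyclic order starting from the gap.
      rcases hne c hc with h | h
      · refine ⟨b, hb, fun q hq => ⟨a, ha, c, hc, hab.ne, hbc.ne', Or.inl ⟨hab, hbc, Or.inl ?_⟩⟩⟩
        exact (hside q hq c hc).1 h
      · rcases hne a ha with h' | h'
        · rcases hne b hb with h'' | h''
          · exact ⟨a, ha, fun q hq => ⟨b, hb, c, hc, hab.ne', (hab.trans hbc).ne',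
              Or.inr ⟨(hside q hq b hb).1 h'', (hside q hq c hc).2 h, Or.inr hab⟩⟩⟩
          · exact ⟨c, hc, fun q hq => ⟨a, ha, b, hb, (hab.trans hbc).ne, hbc.ne,
              Or.inr ⟨(hside q hq a ha).1 h', (hside q hq b hb).2 h'', Or.inl hbc⟩⟩⟩
        · refine ⟨b, hb, fun q hq => ⟨a, ha, c, hc, hab.ne, hbc.ne',
            Or.inl ⟨hab, hbc, Or.inr ?_⟩⟩⟩
          exact (hside q hq a ha).2 h'
    · push Not at hgap
      exact ⟨b, hb, fun q hq => absurd (hgap q) hq⟩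

end Finset

/-! ### Connected vertex sets of the cycle are the arcs. -/

namespace SimpleGraph

/-- Vertices on the two sides of a cut without crossing edges prevent connectedness. -/
theorem not_connected_induce_of_cut {V : Type*} {G : SimpleGraph V} {S : Set V} (T : Set V)
    (hT : ∀ a ∈ S, ∀ b ∈ S, G.Adj a b → a ∈ T → b ∈ T) {x y : V} (hx : x ∈ S) (hy : y ∈ S)
    (hxT : x ∈ T) (hyT : y ∉ T) : ¬ (G.induce S).Connected := by
  intro h
  obtain ⟨w⟩ := h.preconnected ⟨x, hx⟩ ⟨y, hy⟩
  have : ∀ (a b : S), (G.induce S).Walk a b → a.1 ∈ T → b.1 ∈ T := by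
    intro a b w
    induction w with
    | nil => exact id
    | cons hab _ ih => exact fun ha => ih (hT _ (Subtype.prop _) _ (Subtype.prop _) hab ha)
  exact hyT (this _ _ w hxT)

/-- Two missing vertices `a < b` cut the cycle, so `S` lies wholly inside or wholly outside the
interval between them; this excludes failing both alternatives of an arc. -/
theorem isCycleArc_of_connected {n : ℕ} (hn : 3 ≤ n) {S : Finset (Fin n)}
    (h : ((cycleGraph n).induce (S : Set (Fin n))).Connected) : S.IsCycleArc := by
  have key : ∀ a b x y, a < x → x < b → a ∉ S → b ∉ S → x ∈ S → y ∈ S → a < y ∧ y < b := by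
    intro a b x y hax hxb ha hb hx hy
    by_contra hyab
    refine not_connected_induce_of_cut (Set.Ioo a b) ?_ hx hy ⟨hax, hxb⟩ hyab h
    rintro c hc d hd hcd ⟨hac, hcb⟩
    rw [cycleGraph_adj_iff_val (by omega)] at hcd
    have hda : d ≠ a := fun h => ha (h ▸ hd)
    have hdb : d ≠ b := fun h => hb (h ▸ hd)
    rw [Ne, Fin.ext_iff] at hda hdb
    rw [Fin.lt_def] at hac hcb
    have hb' := b.2
    simp only [Set.mem_Ioo, Fin.lt_def]
    omega
  by_contra hS
  rw [Finset.IsCycleArc, not_or] at hS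
  obtain ⟨h1, h2⟩ := hS
  push Not at h1 h2
  obtain ⟨p, q, s, hpq, hqs, hp, hs, hq⟩ := h1
  obtain ⟨a, x, b, hax, hxb, ha, hb, hx⟩ := h2
  have hpab := key a b x p hax hxb ha hb hx hp
  have hsab := key a b x s hax hxb ha hb hx hs
  have := key a q p s hpab.1 hpq ha hq hp hs
  exact absurd this.2 (not_lt.2 hqs.le)

theorem connected_of_isCycleArc {n : ℕ} (hn : 3 ≤ n) {S : Finset (Fin n)} (hne : S.Nonempty)
    (h : S.IsCycleArc) : ((cycleGraph n).induce (S : Set (Fin n))).Connected := by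
  have hseg : ∀ (k : ℕ) (a b : Fin n) (ha : a ∈ S) (hb : b ∈ S), a.val + k = b.val →
      (∀ c, a ≤ c → c ≤ b → c ∈ S) →
      ((cycleGraph n).induce (S : Set (Fin n))).Reachable ⟨a, ha⟩ ⟨b, hb⟩ := by
    intro k
    induction k with
    | zero =>
      intro a b ha hb hab _
      obtain rfl : a = b := Fin.ext hab
      exact Reachable.refl _
    | succ k ih =>
      intro a b ha hb hab hS
      have hb' := b.2
      let c : Fin n := ⟨a.val + k, by omega⟩
      have hcv : c.val = a.val + k := rfl
      have hc : c ∈ S := hS c (by rw [Fin.le_def]; omega) (by rw [Fin.le_def]; omega)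
      refine (ih a c ha hc rfl fun d h1 h2 => hS d h1 (h2.trans ?_)).trans (Adj.reachable ?_)
      · rw [Fin.le_def]; omega
      · change (cycleGraph n).Adj c b
        rw [cycleGraph_adj_iff_val (by omega)]
        omega
  have hseg' : ∀ (a b : Fin n) (ha : a ∈ S) (hb : b ∈ S), a ≤ b →
      (∀ c, a ≤ c → c ≤ b → c ∈ S) →
      ((cycleGraph n).induce (S : Set (Fin n))).Reachable ⟨a, ha⟩ ⟨b, hb⟩ :=
    fun a b ha hb hab => hseg (b.val - a.val) a b ha hb (by rw [Fin.le_def] at hab; omega)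
  have : Nonempty (S : Set (Fin n)) := hne.to_subtype
  refine ⟨?_⟩
  have hle : ∀ (a b : Fin n) (ha : a ∈ S) (hb : b ∈ S), a ≤ b →
      ((cycleGraph n).induce (S : Set (Fin n))).Reachable ⟨a, ha⟩ ⟨b, hb⟩ := by
    intro a b ha hb hab
    by_cases hall : ∀ c, a ≤ c → c ≤ b → c ∈ S
    · exact hseg' a b ha hb hab hall
    · push Not at hall
      obtain ⟨g, hag, hgb, hg⟩ := hall
      have hag' : a < g := lt_of_le_of_ne hag fun h => hg (h ▸ ha)
      have hgb' : g < b := lt_of_le_of_ne hgb fun h => hg (h ▸ hb)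
      rcases h with h | h
      · exact absurd (h a g b hag' hgb' ha hb) hg
      -- With a gap between `a` and `b`, the path goes the other way round, through the edge joining
      -- `0` and `n - 1`.
      · let z : Fin n := ⟨0, by omega⟩
        let t : Fin n := ⟨n - 1, by omega⟩
        have hz : ∀ c, z ≤ c := fun c => Nat.zero_le _
        have ht : ∀ c, c ≤ t := fun c => Nat.le_sub_one_of_lt c.2
        have hlow : ∀ c, c ≤ a → c ∈ S := by
          intro c hc
          by_contra hcS
          exact h c a g (lt_of_le_of_ne hc fun h => hcS (h ▸ ha)) hag' hcS hg ha
        have hhigh : ∀ c, b ≤ c → c ∈ S := by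
          intro c hc
          by_contra hcS
          exact h g b c hgb' (lt_of_le_of_ne hc fun h => hcS (h ▸ hb)) hg hcS hb
        have hzS := hlow z (hz a)
        have htS := hhigh t (ht b)
        refine (hseg' z a hzS ha (hz a) fun c _ hc => hlow c hc).symm.trans
          (Reachable.trans (Adj.reachable ?_)
            (hseg' b t hb htS (ht b) fun c hc _ => hhigh c hc).symm)
        change (cycleGraph n).Adj z t
        rw [cycleGraph_adj_iff_val (by omega)]
        change 0 + 1 = n - 1 ∨ n - 1 + 1 = 0 ∨ (0 = 0 ∧ n - 1 + 1 = n) ∨ _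
        omega
  rintro ⟨a, ha⟩ ⟨b, hb⟩
  rcases le_total a b with hab | hab
  · exact hle a b ha hb hab
  · exact (hle b a hb ha hab).symm

theorem mem_connectedClutter_cycleGraph {n : ℕ} (hn : 3 ≤ n) {r : ℕ} {S : Finset (Fin n)} :
    S ∈ ((cycleGraph n).connectedClutter r).edges ↔ S.card = r + 1 ∧ S.IsCycleArc :=
  and_congr_right fun h =>
    ⟨isCycleArc_of_connected hn, connected_of_isCycleArc hn (Finset.card_pos.1 (by omega))⟩

end SimpleGraph

/-! ### Chordality. -/

namespace UniformClutter

variable {V : Type u} {d : ℕ}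

/-- A clutter is chordal if each of its nonempty subclutters has a simplicial maximal subedge. -/
theorem isChordal_of_forall_exists_isSimplicial [Finite V] [DecidableEq V]
    (C : UniformClutter V d)
    (h : ∀ C' : UniformClutter V d, C'.edges ⊆ C.edges → C'.edges.Nonempty →
      ∃ σ, C'.IsSimplicial σ) : C.IsChordal := by
  induction hk : C.edges.ncard using Nat.strong_induction_on generalizing C with
  | _ k ih =>
    rcases C.edges.eq_empty_or_nonempty with h0 | hne
    · exact .of_edges_eq_empty C h0
    · obtain ⟨σ, hσ⟩ := h C subset_rfl hne
      refine .of_delete C σ hσ (ih _ ?_ (C.delete σ) (fun C' hC' => h C' (hC'.trans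
        fun _ he => he.1)) rfl)
      rw [← hk]
      -- A maximal subedge lies in some edge, so its deletion is strictly smaller.
      refine Set.ncard_lt_ncard ⟨fun _ he => he.1, fun hsub => hσ.1.2 ?_⟩ (Set.toFinite _)
      refine Set.union_eq_self_of_subset_right fun v hv => ?_
      exact absurd (Finset.subset_insert v σ) (hsub hv).2

/-- A subedge contained in a single edge is simplicial. -/
theorem isSimplicial_of_unique [DecidableEq V] (C : UniformClutter V d) {σ e : Finset V}
    (he : e ∈ C.edges) (hσe : σ ⊆ e) (hcard : σ.card + 1 = d)
    (huniq : ∀ e' ∈ C.edges, σ ⊆ e' → e' = e) : C.IsSimplicial σ := by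
  have hed := C.card_eq e he
  obtain ⟨v, hv, hvσ⟩ : ∃ v ∈ e, v ∉ σ := by
    by_contra! h
    have := Finset.card_le_card h
    omega
  have hins : insert v σ = e := Finset.eq_of_subset_of_card_le
    (Finset.insert_subset hv hσe) (by rw [Finset.card_insert_of_notMem hvσ]; omega)
  refine ⟨⟨hcard, fun h => hvσ ?_⟩, fun f hf hfN => ?_⟩
  · rw [← Finset.mem_coe, ← h]
    exact Or.inr (by rw [Set.mem_ofPred_eq, hins]; exact he)
  · have hfe : f ⊆ e := by
      intro w hw
      rcases hfN hw with h | h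
      · exact hσe h
      · rw [← huniq _ h (Finset.subset_insert w σ)]
        exact Finset.mem_insert_self w σ
    rwa [Finset.eq_of_subset_of_card_le hfe (by omega)]

theorem isChordal_connectedClutter_cycleGraph {n : ℕ} (hn : 3 ≤ n) {r : ℕ} (hr : 2 ≤ r) :
    ((SimpleGraph.cycleGraph n).connectedClutter r).IsChordal := by
  refine isChordal_of_forall_exists_isSimplicial _ fun C hC hne => ?_
  obtain ⟨e, he⟩ := hne
  have hed := C.card_eq e he
  by_cases hfull : ∀ f : Finset (Fin n), f.card = r + 1 → f ∈ C.edges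
  · obtain ⟨m, hm⟩ : e.Nonempty := Finset.card_pos.1 (by omega)
    refine ⟨e.erase m, ⟨by rw [Finset.card_erase_of_mem hm]; omega, fun h => ?_⟩,
      fun f hf _ => hfull f hf⟩
    refine Finset.notMem_erase m e ?_
    rw [← Finset.mem_coe, ← h]
    exact Or.inr (by rw [Set.mem_ofPred_eq, Finset.insert_erase hm]; exact he)
  · push Not at hfull
    obtain ⟨f, hf, hfC⟩ := hfull
    rcases Nat.lt_or_ge n (r + 3) with hlt | hge
    -- Two distinct `(r + 1)`-sets force `n = r + 2`. Then `e` and `f` are the only sets of this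
    -- size containing `e ∩ f`, and `f` is not an edge.
    · have hef : e ≠ f := by
        rintro rfl
        exact hfC he
      have hunion : (e ∪ f).card ≤ n := by simpa using Finset.card_le_univ (e ∪ f)
      have hinter := Finset.card_union_add_card_inter e f
      have hlt' : (e ∩ f).card < e.card := by
        refine Finset.card_lt_card ⟨Finset.inter_subset_left, fun h => hef ?_⟩
        exact Finset.eq_of_subset_of_card_le (h.trans Finset.inter_subset_right) (by omega)
      refine ⟨e ∩ f, C.isSimplicial_of_unique he Finset.inter_subset_left (by omega)
        fun e' he' hsub => ?_⟩
      have he'd := C.card_eq e' he'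
      have huniv : e ∪ f = Finset.univ := by
        rw [← Finset.card_eq_iff_eq_univ, Fintype.card_fin]
        omega
      obtain ⟨v, hv, hvs⟩ : ∃ v ∈ e', v ∉ e ∩ f := by
        by_contra! h
        have := Finset.card_le_card (show e' ⊆ e ∩ f from h)
        omega
      have hins : insert v (e ∩ f) = e' := Finset.eq_of_subset_of_card_le
        (Finset.insert_subset hv hsub) (by rw [Finset.card_insert_of_notMem hvs]; omega)
      rcases Finset.mem_union.1 (huniv ▸ Finset.mem_univ v) with h | h
      · rw [← hins]
        exact Finset.eq_of_subset_of_card_le (Finset.insert_subset h Finset.inter_subset_left)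
          (by rw [Finset.card_insert_of_notMem hvs]; omega)
      · refine absurd he' ?_
        rw [← hins, Finset.eq_of_subset_of_card_le
          (Finset.insert_subset h Finset.inter_subset_right)
          (by rw [Finset.card_insert_of_notMem hvs]; omega)]
        exact hfC
    · have harc := ((SimpleGraph.mem_connectedClutter_cycleGraph hn).1 (hC he)).2
      obtain ⟨m, hm, hex⟩ := harc.exists_not_isCycleArc_exchange (by omega) (by omega)
      have hcard := Finset.card_erase_of_mem hm
      refine ⟨e.erase m, C.isSimplicial_of_unique he (Finset.erase_subset m e) (by omega)
        fun e' he' hsub => ?_⟩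
      have he'd := C.card_eq e' he'
      obtain ⟨v, hv, hvs⟩ : ∃ v ∈ e', v ∉ e.erase m := by
        by_contra! h
        have := Finset.card_le_card (show e' ⊆ e.erase m from h)
        omega
      have hins : insert v (e.erase m) = e' := Finset.eq_of_subset_of_card_le
        (Finset.insert_subset hv hsub) (by rw [Finset.card_insert_of_notMem hvs]; omega)
      have harc' := ((SimpleGraph.mem_connectedClutter_cycleGraph hn).1 (hC he')).2
      rw [← hins] at harc' ⊢
      by_cases hve : v ∈ e
      · obtain rfl : v = m := by
          by_contra hvm
          exact hvs (Finset.mem_erase.2 ⟨hvm, hve⟩)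
        exact Finset.insert_erase hm
      · exact absurd harc' (hex v hve)

end UniformClutter

/-! ### Linear quotients for the non-arcs. -/

theorem UniformClutter.hasLinearResolution_edgeIdeal_compl_cycleGraph {n : ℕ} (hn : 3 ≤ n) {r : ℕ}
    (hr : 2 ≤ r) (K : Type v) [Field K] :
    (((SimpleGraph.cycleGraph n).connectedClutter r).compl.edgeIdeal K).HasLinearResolution
      (r + 1) := by
  let C := ((SimpleGraph.cycleGraph n).connectedClutter r).compl
  let E : Finset (Finset (Fin n)) := C.edges.toFinite.toFinset
  have hE : ∀ e, e ∈ E ↔ e.card = r + 1 ∧ ¬ e.IsCycleArc := by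
    intro e
    have : e ∈ E ↔ e.card = r + 1 ∧ e ∉ ((SimpleGraph.cycleGraph n).connectedClutter r).edges :=
      Set.Finite.mem_toFinset _
    rw [this, SimpleGraph.mem_connectedClutter_cycleGraph hn]
    tauto
  -- In the dual colexicographic order, an earlier `v` contains the largest element of its symmetric
  -- difference with `u`. Exchanging `y` for a larger `z` moves `u` to an earlier generator.
  obtain ⟨p, hp⟩ := exists_hasLinearComplex_of_linear_quotients (K := K)
    (fun e : Finset (Fin n) => OrderDual.toDual (toColex e))
    (fun _ _ h => h) (d := r + 1) E (fun e he => ((hE e).1 he).1) (by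
      intro u hu v hv hlt
      obtain ⟨hud, hu'⟩ := (hE u).1 hu
      obtain ⟨hvd, hv'⟩ := (hE v).1 hv
      obtain ⟨x, hx, hxeq⟩ := Finset.Colex.lt_iff_exists_filter_lt.1
        (OrderDual.toDual_lt_toDual.1 hlt)
      rw [Finset.mem_sdiff] at hx
      obtain ⟨z, hz, hzu, y, hy, hyz, hw⟩ := Finset.exists_exchange_not_isCycleArc
        (hud.trans hvd.symm) (by omega) hu' hv' hx.1 hx.2 fun b hb => by
          simpa [hb] using Finset.ext_iff.1 hxeq b
      refine ⟨z, hz, hzu, (insert z u).erase y, (hE _).2 ⟨?_, hw⟩, ?_, Finset.erase_subset _ _⟩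
      · rw [Finset.card_erase_of_mem (Finset.mem_insert_of_mem hy),
          Finset.card_insert_of_notMem hzu]
        omega
      · rw [OrderDual.toDual_lt_toDual, Finset.Colex.lt_iff_exists_filter_lt]
        refine ⟨z, ?_, ?_⟩
        · rw [Finset.mem_sdiff, Finset.mem_erase]
          exact ⟨⟨hyz.ne', Finset.mem_insert_self z u⟩, hzu⟩
        · ext b
          rw [Finset.mem_filter, Finset.mem_filter, Finset.mem_erase, Finset.mem_insert]
          refine and_congr_left fun hb => ?_
          simp [hb.ne', (hyz.trans hb).ne'])
  have hI : C.edgeIdeal K = Ideal.span ((fun e => ∏ x ∈ e, X x) '' (E : Set (Finset (Fin n)))) := by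
    rw [UniformClutter.edgeIdeal, Set.Finite.coe_toFinset]
    congr 1
    ext m
    simp only [Set.mem_image, Set.mem_ofPred_eq, eq_comm]
  rw [← hI] at hp
  exact hp.hasLinearResolution

theorem mainTheorem11 (n : ℕ) (hn : 3 ≤ n) (r : ℕ) (hr : 2 ≤ r) :
    ((SimpleGraph.cycleGraph n).connectedClutter r).IsChordal ∧
      ∀ (K : Type v) [Field K],
        (((SimpleGraph.cycleGraph n).connectedClutter r).compl.edgeIdeal K).HasLinearResolution
          (r + 1) :=
  ⟨UniformClutter.isChordal_connectedClutter_cycleGraph hn hr, fun K _ =>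
    UniformClutter.hasLinearResolution_edgeIdeal_compl_cycleGraph hn hr K⟩
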